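/- Let $\mathrm{Sym}(n)$ be the space of real symmetric $n\times n$ matrices, let $\mathrm{SPD}(n)\subset \mathrm{Sym}(n)$ be the open subset of positive definite matrices, and let $m=\dim \mathrm{SPD}(n)=n(n+1)/2$. Equip $\mathrm{SPD}(n)$ with the affine-invariant Riemannian metric $\langle V,W\rangle_P=\mathrm{Tr}(P^{-1}VP^{-1}W)$, whose distance and Riemannian logarithm are $$d(P,Q)^2=\mathrm{Tr}\bigl(\log(P^{-1/2}QP^{-1/2})^2\bigr),\qquad \log_P Q=P^{1/2}\log(P^{-1/2}QP^{-1/2})P^{1/2}\in \mathrm{Sym}(n).$$ Let $R_1,\dots,R_\ell\in \mathrm{SPD}(n)$ with $\ell\ge m$, and let $F:\mathrm{SPD}(n)\to\mathbb{R}^\ell$, $F(P)=(d(R_1,P)^2,\dots,d(R_\ell,P)^2)$, be the squared Fréchet map. Put $$\Gamma=\{P\in \mathrm{SPD}(n):\ \operatorname{rank}(\log_P R_1,\dots,\log_P R_\ell)=m\},\qquad S=\{P\in\mathrm{SPD}(n):\ \operatorname{rank} DF(P)<m\}.$$ Theorem. Suppose that there is $Q\in \mathrm{SPD}(n)$ such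 that $\{\log_Q R_1,\dots,\log_Q R_\ell\}$ has rank $m$. Then $F$ is differentiable on $\mathrm{SPD}(n)$, $S=\mathrm{SPD}(n)\setminus\Gamma$, and $S$ has Lebesgue measure zero in $\mathrm{Sym}(n)$. In other words, $\Gamma$ is an open subset of full Lebesgue measure in $\mathrm{SPD}(n)$ (that is, $\mathrm{SPD}(n)\setminus\Gamma$ is a null set), and $F$ is locally invertible at every $P\in\Gamma$: $DF(P)$ has rank $m$, and $F$ restricts to a smooth diffeomorphism from some open neighbourhood of $P$ onto its image in $\mathbb{R}^\ell$ (it is smooth there and has a left inverse that is smooth on an open set containing the image). -/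

import Mathlib

open MeasureTheory Set
open scoped ContDiff

attribute [local instance] Matrix.frobeniusNormedAddCommGroup Matrix.frobeniusNormedSpace

/-- The space `Sym(n)` of real symmetric `n × n` matrices, with the Frobenius norm. -/
def SymMat (n : ℕ) : Submodule ℝ (Matrix (Fin n) (Fin n) ℝ) where
  carrier := {A | A.IsSymm}
  add_mem' ha hb := ha.add hb
  zero_mem' := Matrix.isSymm_zero
  smul_mem' c _ ha := ha.smul c

/-- The set `SPD(n)` of symmetric positive definite matrices, as a subset of `Sym(n)`.
It is open, so its tangent space at every point is `Sym(n)`. -/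
def SPD (n : ℕ) : Set (SymMat n) :=
  {P | (P : Matrix (Fin n) (Fin n) ℝ).PosDef}

/-- The dimension `n (n + 1) / 2` of `Sym(n)` and of `SPD(n)`. -/
def symDim (n : ℕ) : ℕ := n * (n + 1) / 2

/-! ### Lebesgue measure on `Sym(n)` -/

/-- The linear coordinates of a symmetric matrix: its entries `(i, j)` with `i ≤ j`. -/
def symCoords (n : ℕ) : SymMat n ≃ₗ[ℝ] ({p : Fin n × Fin n // p.1 ≤ p.2} → ℝ) where
  toFun A p := (A : Matrix (Fin n) (Fin n) ℝ) p.1.1 p.1.2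
  map_add' _ _ := rfl
  map_smul' _ _ := rfl
  invFun x := ⟨Matrix.of fun i j =>
      x ⟨(min i j, max i j), min_le_max⟩, by
    ext i j
    simp [Matrix.transpose_apply, min_comm, max_comm]⟩
  left_inv A := by
    ext i j
    rcases le_total i j with h | h
    · simp [h]
    · simpa [h] using A.2.apply i j
  right_inv x := by
    ext ⟨⟨i, j⟩, h⟩
    have h' : i ≤ j := h
    simp [h']

noncomputable instance (n : ℕ) : MeasurableSpace (SymMat n) := borel _

instance (n : ℕ) : BorelSpace (SymMat n) := ⟨rfl⟩

/-- Lebesgue measure on `Sym(n)`, in the coordinates given by the entries `(i, j)`, `i ≤ j`. -/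
noncomputable def symLebesgue (n : ℕ) : Measure (SymMat n) :=
  (volume : Measure ({p : Fin n × Fin n // p.1 ≤ p.2} → ℝ)).map
    (symCoords n).symm.toContinuousLinearEquiv

instance (n : ℕ) : (symLebesgue n).IsAddHaarMeasure :=
  ContinuousLinearEquiv.isAddHaarMeasure_map _ _

/-! ### The affine-invariant geometry of `SPD(n)` -/

/-- The square root `P^{1/2}` of a symmetric positive semidefinite matrix. -/
noncomputable def matSqrt {n : ℕ} (P : Matrix (Fin n) (Fin n) ℝ) : Matrix (Fin n) (Fin n) ℝ :=
  cfc Real.sqrt P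

/-- The matrix logarithm of a symmetric positive definite matrix. -/
noncomputable def matLog {n : ℕ} (P : Matrix (Fin n) (Fin n) ℝ) : Matrix (Fin n) (Fin n) ℝ :=
  cfc Real.log P

/-- `log (P^{-1/2} Q P^{-1/2})`. -/
noncomputable def relLog {n : ℕ} (P Q : Matrix (Fin n) (Fin n) ℝ) : Matrix (Fin n) (Fin n) ℝ :=
  matLog ((matSqrt P)⁻¹ * Q * (matSqrt P)⁻¹)

/-- The affine-invariant Riemannian distance,
`d(P, Q) = (Tr (log (P^{-1/2} Q P^{-1/2})^2))^{1/2}`. -/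
noncomputable def spdDist {n : ℕ} (P Q : SymMat n) : ℝ :=
  Real.sqrt (relLog (P : Matrix (Fin n) (Fin n) ℝ) Q ^ 2).trace

theorem isSymm_cfc {n : ℕ} (f : ℝ → ℝ) (A : Matrix (Fin n) (Fin n) ℝ) : (cfc f A).IsSymm := by
  have h : IsSelfAdjoint (cfc f A) := cfc_predicate f A
  rw [Matrix.IsSymm, ← Matrix.conjTranspose_eq_transpose_of_trivial]
  exact h

/-- The Riemannian logarithm map of the affine-invariant metric,
`log_P Q = P^{1/2} log (P^{-1/2} Q P^{-1/2}) P^{1/2}`, with values in `T_P SPD(n) = Sym(n)`. -/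
noncomputable def spdLog {n : ℕ} (P Q : SymMat n) : SymMat n :=
  ⟨matSqrt (P : Matrix (Fin n) (Fin n) ℝ) * relLog (P : Matrix (Fin n) (Fin n) ℝ) Q *
      matSqrt (P : Matrix (Fin n) (Fin n) ℝ), by
    have h₁ : (matSqrt (P : Matrix (Fin n) (Fin n) ℝ)).IsSymm := isSymm_cfc _ _
    have h₂ : (relLog (P : Matrix (Fin n) (Fin n) ℝ) Q).IsSymm := isSymm_cfc _ _
    change (_ * _ * _ : Matrix (Fin n) (Fin n) ℝ).IsSymm
    rw [Matrix.IsSymm, Matrix.transpose_mul, Matrix.transpose_mul, h₁.eq, h₂.eq, mul_assoc]⟩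

/-! ### The squared Fréchet map -/

/-- The squared Fréchet map `F(P) = (d(R_1, P)^2, …, d(R_ℓ, P)^2)`. -/
noncomputable def frechetMap {n ℓ : ℕ} (R : Fin ℓ → SymMat n) (P : SymMat n) : Fin ℓ → ℝ :=
  fun i => spdDist (R i) P ^ 2

/-- The rank of the family of tangent vectors `(log_P R_1, …, log_P R_ℓ)`. -/
noncomputable def logRank {n ℓ : ℕ} (R : Fin ℓ → SymMat n) (P : SymMat n) : ℕ :=
  Module.finrank ℝ (Submodule.span ℝ (range fun i => spdLog P (R i)))

/-- The rank of the differential `DF(P)` of the squared Fréchet map. -/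
noncomputable def diffRank {n ℓ : ℕ} (R : Fin ℓ → SymMat n) (P : SymMat n) : ℕ :=
  Module.finrank ℝ (LinearMap.range (fderiv ℝ (frechetMap R) P).toLinearMap)

/-- `Γ_R`: the points of `SPD(n)` where `(log_P R_1, …, log_P R_ℓ)` has full rank. -/
def fullRankSet {n ℓ : ℕ} (R : Fin ℓ → SymMat n) : Set (SymMat n) :=
  {P | P ∈ SPD n ∧ logRank R P = symDim n}

/-- `S_R`: the points of `SPD(n)` where the differential `DF(P)` is rank deficient. -/
def rankDeficientSet {n ℓ : ℕ} (R : Fin ℓ → SymMat n) : Set (SymMat n) :=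
  {P | P ∈ SPD n ∧ diffRank R P < symDim n}

/-- `F` is locally invertible at `P`: its differential at `P` has rank `dim SPD(n)`, and `F` is a
smooth diffeomorphism from an open neighbourhood `U` of `P` in `SPD(n)` onto its image `F(U)`: it
is smooth on `U` and has a left inverse there which is smooth on an open set containing `F(U)`. -/
def LocallyInvertibleAt {n ℓ : ℕ} (R : Fin ℓ → SymMat n) (P : SymMat n) : Prop :=
  diffRank R P = symDim n ∧
    ∃ U : Set (SymMat n), IsOpen U ∧ P ∈ U ∧ U ⊆ SPD n ∧ ContDiffOn ℝ ∞ (frechetMap R) U ∧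
      ∃ (W : Set (Fin ℓ → ℝ)) (G : (Fin ℓ → ℝ) → SymMat n),
        IsOpen W ∧ MapsTo (frechetMap R) U W ∧ ContDiffOn ℝ ∞ G W ∧
          ∀ X ∈ U, G (frechetMap R X) = X

/-!
The argument has two halves: a gradient formula, which turns the rank of the logarithms into the
rank of `DF`, and the analyticity of `F`, which makes the bad set the zero set of an analytic
function.

*Analyticity.* With `S = R^{-1/2}`, the squared distance is `d(R, P)² = Tr (log (S P S)²)`. For a
positive definite `A` and a large constant `c`, the operator norm of `A / c - 1` is less than one,
so that near `A` the matrix logarithm is `log c` plus the power series of `log (1 + y)` at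
`y = A / c - 1` (`toOp_matLog`). Conversely a symmetric matrix with this property is positive
definite, so the cone is open (`isOpen_SPD`). The series is treated in an abstract Banach algebra
(`analyticOnNhd_logOneAdd`); matrices are mapped into the operators on Euclidean space to have the
right norm.

*Gradient.* Under a trace against an element commuting with `y`, the derivative of `log (1 + y)` is
multiplication with `(1 + y)⁻¹` (`apply_mul_fderiv_logOneAdd`). Together with the conjugation
identity `log (P^{-1/2} R P^{-1/2}) T = -T log (R^{-1/2} P R^{-1/2})` for `T = P^{1/2} R^{-1/2}`
(`matLog_mul_eq_neg_mul_matLog`) this yields `D_P d(R, P)² [V] = -2 ⟨log_P R, V⟩_P`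
(`fderiv_spdDist_sq_eq_inner`). As the metric is nondegenerate, the kernel of `DF(P)` is the
orthogonal complement of the span of the logarithms, so both ranks agree (`diffRank_eq_logRank`).

*Null set and openness.* If `DF(Q)` is injective with left inverse `L`, then `P ↦ det (L ∘ DF(P))`
is analytic, nonzero at `Q`, and its nonvanishing forces `DF(P)` to be injective
(`exists_analytic_ne_zero_imp_injective`). Its zero set in the convex open cone is a null set
(`addHaar_analyticZeros_eq_zero`).

*Local inverse.* The analytic inverse function theorem applies to `L ∘ F`
(`exists_local_leftInverse`).
-/

/-! ### The logarithm series in a Banach algebra -/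

section LogSeries

open FormalMultilinearSeries Filter Topology
open scoped RightActions

variable {𝔸 : Type*} [NormedRing 𝔸]

theorem norm_pow_mul_mul_pow_le (x v : 𝔸) (a b : ℕ) :
    ‖x ^ a * v * x ^ b‖ ≤ ‖x‖ ^ (a + b) * ‖v‖ := by
  have hl : ∀ (w : 𝔸) (k : ℕ), ‖x ^ k * w‖ ≤ ‖x‖ ^ k * ‖w‖ := fun w k => by
    induction k with
    | zero => simp
    | succ k ih =>
      rw [pow_succ', mul_assoc, pow_succ', mul_assoc]
      exact (norm_mul_le _ _).trans (by gcongr)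
  have hr : ∀ (w : 𝔸) (k : ℕ), ‖w * x ^ k‖ ≤ ‖x‖ ^ k * ‖w‖ := fun w k => by
    induction k with
    | zero => simp
    | succ k ih =>
      rw [pow_succ, ← mul_assoc, pow_succ]
      calc ‖w * x ^ k * x‖ ≤ ‖w * x ^ k‖ * ‖x‖ := norm_mul_le _ _
        _ ≤ ‖x‖ ^ k * ‖w‖ * ‖x‖ := by gcongr
        _ = ‖x‖ ^ k * ‖x‖ * ‖w‖ := by ring
  calc ‖x ^ a * v * x ^ b‖ ≤ ‖x‖ ^ b * (‖x‖ ^ a * ‖v‖) := (hr _ _).trans (by gcongr; exact hl _ _)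
    _ = ‖x‖ ^ (a + b) * ‖v‖ := by ring

variable [NormedAlgebra ℝ 𝔸]

/-- The coefficient `(-1) ^ (n + 1) / n` of the power series of `log (1 + y)`. At `n = 0` the
division by zero yields the correct value `0`. -/
noncomputable def logCoeff (n : ℕ) : ℝ := -(-1) ^ n / n

/-- The logarithm series `log (1 + y) = ∑ (-1) ^ (n + 1) / n • y ^ n` in a normed algebra,
meaningful for `‖y‖ < 1`. -/
noncomputable def logOneAdd (y : 𝔸) : 𝔸 := ∑' n : ℕ, logCoeff n • y ^ n

theorem logCoeff_zero : logCoeff 0 = 0 := by simp [logCoeff]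

theorem logCoeff_succ_mul (n : ℕ) : logCoeff (n + 1) * (n + 1 : ℝ) = (-1) ^ n := by
  rw [logCoeff]
  push_cast
  field_simp
  ring

theorem norm_logCoeff_le (n : ℕ) : ‖logCoeff n‖ ≤ 1 := by
  rcases n.eq_zero_or_pos with rfl | hn
  · simp [logCoeff]
  · have : (1 : ℝ) ≤ n := by exact_mod_cast hn
    simp only [logCoeff, norm_div, norm_neg, norm_pow, norm_one, one_pow, Real.norm_natCast]
    exact div_le_one_of_le₀ this (by positivity)

theorem hasSum_logCoeff {x : ℝ} (hx : |x| < 1) :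
    HasSum (fun n => logCoeff n * x ^ n) (Real.log (1 + x)) := by
  have h := (Real.hasSum_pow_div_log_of_abs_lt_one (x := -x) (by rwa [abs_neg])).neg
  rw [neg_neg, sub_neg_eq_add] at h
  rw [← hasSum_nat_add_iff' 1]
  simp only [Finset.range_one, Finset.sum_singleton, logCoeff_zero, zero_mul, sub_zero]
  refine h.congr_fun fun n => ?_
  rw [logCoeff, neg_pow x]
  push_cast
  ring

theorem analyticOnNhd_logOneAdd [CompleteSpace 𝔸] :
    AnalyticOnNhd ℝ (logOneAdd : 𝔸 → 𝔸) (Metric.ball 0 1) := by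
  have hr : (1 : ENNReal) ≤ (ofScalars 𝔸 logCoeff).radius := by
    refine (ofScalars 𝔸 logCoeff).le_radius_of_bound (r := 1) 1 fun n => ?_
    rcases n.eq_zero_or_pos with rfl | hn
    · rw [ofScalars_eq_zero_of_scalar_zero 𝔸 logCoeff_zero]
      simp
    · simpa using (ofScalars_norm_le 𝔸 logCoeff n hn).trans (norm_logCoeff_le n)
  have h := (ofScalars 𝔸 logCoeff).hasFPowerSeriesOnBall (lt_of_lt_of_le one_pos hr)
  have he : (ofScalars 𝔸 logCoeff).sum = (logOneAdd : 𝔸 → 𝔸) :=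
    ofScalarsSum_eq_tsum logCoeff
  rw [he] at h
  refine (h.mono one_pos hr).analyticOnNhd.mono ?_
  simp [← Metric.eball_ofReal]

/-- The derivative of the logarithm series, paired with a tracial functional and an element
commuting with the base point, is that of the scalar logarithm: inside the trace the factors `y`
of each monomial can be collected, and a geometric series remains. -/
theorem apply_mul_fderiv_logOneAdd [CompleteSpace 𝔸] (τ : 𝔸 →L[ℝ] ℝ)
    (hτ : ∀ a b, τ (a * b) = τ (b * a)) {y C B : 𝔸} (hy : ‖y‖ < 1) (hC : Commute C y)
    (hB : B * (1 + y) = 1) (V : 𝔸) :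
    τ (C * fderiv ℝ logOneAdd y V) = τ (C * B * V) := by
  obtain ⟨r, hyr, hr⟩ := exists_between hy
  have hr0 : 0 ≤ r := (norm_nonneg y).trans hyr.le
  set D : ℕ → 𝔸 → 𝔸 →L[ℝ] 𝔸 := fun n x => logCoeff n •
    ∑ i ∈ Finset.range n, x ^ (n.pred - i) •> ContinuousLinearMap.id ℝ 𝔸 <• x ^ i with hD
  have hDv : ∀ n x v, D n x v =
      logCoeff n • ∑ i ∈ Finset.range n, x ^ (n.pred - i) * v * x ^ i := fun n x v => by
    simp [hD]
  have hbound : ∀ n, ∀ x ∈ Metric.ball (0 : 𝔸) r, ‖D n x‖ ≤ r ^ n.pred := fun n x hx => by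
    refine ContinuousLinearMap.opNorm_le_bound _ (by positivity) fun v => ?_
    rw [hDv, norm_smul]
    rcases n with _ | n
    · simp
    have hx' : ‖x‖ ≤ r := (mem_ball_zero_iff.mp hx).le
    have hle : ‖∑ i ∈ Finset.range (n + 1), x ^ ((n + 1).pred - i) * v * x ^ i‖ ≤
        (n + 1) * (r ^ n * ‖v‖) := by
      refine (norm_sum_le_of_le _ fun i hi => ?_).trans_eq
        (by rw [Finset.sum_const, Finset.card_range, nsmul_eq_mul]; push_cast; rfl)
      refine (norm_pow_mul_mul_pow_le _ _ _ _).trans ?_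
      rw [Nat.pred_succ, Nat.sub_add_cancel (Finset.mem_range_succ_iff.mp hi)]
      gcongr
    have hc : ‖logCoeff (n + 1)‖ * (n + 1 : ℝ) = 1 := by
      have := congrArg norm (logCoeff_succ_mul n)
      rw [norm_mul, norm_pow, norm_neg, norm_one, one_pow] at this
      rwa [Real.norm_of_nonneg (r := (n + 1 : ℝ)) (by positivity)] at this
    calc _ ≤ ‖logCoeff (n + 1)‖ * ((n + 1) * (r ^ n * ‖v‖)) := by gcongr
      _ = r ^ n * ‖v‖ := by rw [← mul_assoc, hc, one_mul]
  have hsumm : Summable fun n : ℕ => r ^ n.pred :=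
    (summable_nat_add_iff 1).mp (by simpa using summable_geometric_of_lt_one hr0 hr)
  have hmem : y ∈ Metric.ball (0 : 𝔸) r := mem_ball_zero_iff.mpr hyr
  have hderiv : HasFDerivAt logOneAdd (∑' n, D n y) y := by
    refine hasFDerivAt_tsum_of_isPreconnected hsumm Metric.isOpen_ball
      (convex_ball _ _).isPreconnected (fun n x _ => (hasFDerivAt_pow' n).fun_const_smul _) hbound
      (x₀ := 0) (Metric.mem_ball_self ((norm_nonneg y).trans_lt hyr)) ?_ hmem
    refine summable_of_ne_finset_zero (s := {0}) fun n hn => ?_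
    rw [zero_pow (by simpa using hn), smul_zero]
  have hDsum : Summable fun n => D n y := .of_norm_bounded hsumm fun n => hbound n y hmem
  -- The trace collects the `n` noncommuting monomials of the derivative of `y ^ n`.
  have hterm : ∀ n : ℕ, τ (C * D (n + 1) y V) = τ (C * (-y) ^ n * V) := fun n => by
    have : ∀ i ∈ Finset.range (n + 1),
        τ (C * (y ^ ((n + 1).pred - i) * V * y ^ i)) = τ (C * y ^ n * V) := fun i hi => by
      rw [← mul_assoc, hτ, ← mul_assoc, ← mul_assoc, ← (hC.pow_right i).eq, mul_assoc C, ← pow_add,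
        Nat.pred_succ, Nat.add_sub_cancel' (Finset.mem_range_succ_iff.mp hi)]
    rw [hDv, mul_smul_comm, map_smul, Finset.mul_sum, map_sum, Finset.sum_congr rfl this,
      Finset.sum_const, Finset.card_range, nsmul_eq_mul, smul_eq_mul, ← mul_assoc]
    push_cast
    rw [logCoeff_succ_mul, ← neg_one_smul ℝ y, smul_pow, mul_smul_comm, smul_mul_assoc, map_smul,
      smul_eq_mul]
  have hgeom : HasSum (fun n : ℕ => (-y) ^ n) B := by
    have hy' : ‖-y‖ < 1 := by rwa [norm_neg]
    have hs := summable_geometric_of_norm_lt_one hy'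
    have h1 : (1 + y) * ∑' n : ℕ, (-y) ^ n = 1 := by
      simpa using mul_neg_geom_series (-y) hy'
    have : ∑' n : ℕ, (-y) ^ n = B := by
      rw [← one_mul (∑' n : ℕ, (-y) ^ n), ← hB, mul_assoc, h1, mul_one]
    exact this ▸ hs.hasSum
  let Ψ : (𝔸 →L[ℝ] 𝔸) →L[ℝ] ℝ :=
    τ ∘L ContinuousLinearMap.mul ℝ 𝔸 C ∘L ContinuousLinearMap.apply ℝ 𝔸 V
  let Θ : 𝔸 →L[ℝ] ℝ :=
    τ ∘L (ContinuousLinearMap.mul ℝ 𝔸).flip V ∘L ContinuousLinearMap.mul ℝ 𝔸 C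
  have h1 : HasSum (fun n => τ (C * D n y V)) (τ (C * fderiv ℝ logOneAdd y V)) := by
    rw [hderiv.fderiv]
    exact hDsum.hasSum.mapL Ψ
  have h2 : HasSum (fun n => τ (C * (-y) ^ n * V)) (τ (C * B * V)) := hgeom.mapL Θ
  rw [← hasSum_nat_add_iff' 1] at h1
  simp only [Finset.range_one, Finset.sum_singleton, hDv 0, Finset.range_zero, Finset.sum_empty,
    smul_zero, mul_zero, map_zero, sub_zero, hterm] at h1
  exact h1.unique h2

end LogSeries

/-! ### The matrix logarithm and the cone of positive definite matrices -/

section SpectralCalculus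

open Matrix Unitary Filter Topology

variable {n : ℕ}

/-- The Banach algebra of operators on Euclidean space. Matrices are mapped to it in order to use
the operator norm, for which `‖c⁻¹ • A - 1‖ < 1` whenever `A` is positive definite and `c` is large;
the Frobenius norm on matrices does not have this property. -/
abbrev EuclOp (n : ℕ) : Type := EuclideanSpace ℝ (Fin n) →L[ℝ] EuclideanSpace ℝ (Fin n)

/-- The identification of matrices with operators on Euclidean space. -/
noncomputable abbrev toOp : Matrix (Fin n) (Fin n) ℝ ≃⋆ₐ[ℝ] EuclOp n :=
  Matrix.toEuclideanCLM (n := Fin n) (𝕜 := ℝ)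

/-- The matrix with eigenvalues `d`, diagonalized by the orthogonal matrix `U`. -/
noncomputable def conjDiagonal (U : unitary (Matrix (Fin n) (Fin n) ℝ)) :
    (Fin n → ℝ) →ₗ[ℝ] Matrix (Fin n) (Fin n) ℝ :=
  (conjStarAlgAut ℝ (Matrix (Fin n) (Fin n) ℝ) U).toAlgEquiv.toLinearMap ∘ₗ
    Matrix.diagonalLinearMap (Fin n) ℝ ℝ

theorem conjDiagonal_apply (U : unitary (Matrix (Fin n) (Fin n) ℝ)) (d : Fin n → ℝ) :
    conjDiagonal U d = conjStarAlgAut ℝ (Matrix (Fin n) (Fin n) ℝ) U (diagonal d) := rfl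

theorem conjDiagonal_pow (U : unitary (Matrix (Fin n) (Fin n) ℝ)) (d : Fin n → ℝ) (k : ℕ) :
    conjDiagonal U d ^ k = conjDiagonal U (d ^ k) := by
  rw [conjDiagonal_apply, conjDiagonal_apply, ← map_pow, diagonal_pow]

theorem conjDiagonal_const (U : unitary (Matrix (Fin n) (Fin n) ℝ)) (c : ℝ) :
    conjDiagonal U (fun _ => c) = c • 1 := by
  rw [conjDiagonal_apply, ← smul_one_eq_diagonal, map_smul, map_one]

theorem eq_conjDiagonal {A : Matrix (Fin n) (Fin n) ℝ} (hA : A.IsHermitian) :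
    A = conjDiagonal hA.eigenvectorUnitary hA.eigenvalues :=
  hA.spectral_theorem

theorem cfc_eq_conjDiagonal {A : Matrix (Fin n) (Fin n) ℝ} (hA : A.IsHermitian) (f : ℝ → ℝ) :
    cfc f A = conjDiagonal hA.eigenvectorUnitary (f ∘ hA.eigenvalues) :=
  hA.cfc_eq f

theorem norm_toOp_conjDiagonal (U : unitary (Matrix (Fin n) (Fin n) ℝ)) (d : Fin n → ℝ) :
    ‖toOp (conjDiagonal U d)‖ = ‖d‖ := by
  have hU : toOp (U : Matrix (Fin n) (Fin n) ℝ) ∈ unitary (EuclOp n) :=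
    map_mem toOp U.2
  have hd : ‖toOp (diagonal d)‖ = ‖d‖ :=
    (l2_opNorm_toEuclideanCLM (diagonal d)).trans (l2_opNorm_diagonal d)
  rw [conjDiagonal_apply, conjStarAlgAut_apply, map_mul, map_mul, map_star, mul_assoc,
    CStarRing.norm_mem_unitary_mul _ hU, CStarRing.norm_mul_mem_unitary _ (Unitary.star_mem hU), hd]

theorem inv_smul_sub_one_eq_conjDiagonal {A : Matrix (Fin n) (Fin n) ℝ} (hA : A.IsHermitian)
    (c : ℝ) :
    c⁻¹ • A - 1 = conjDiagonal hA.eigenvectorUnitary (fun i => c⁻¹ * hA.eigenvalues i - 1) := by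
  have h : (fun i => c⁻¹ * hA.eigenvalues i - 1) = c⁻¹ • hA.eigenvalues - fun _ => 1 := rfl
  rw [h, map_sub, map_smul, ← eq_conjDiagonal hA, conjDiagonal_const, one_smul]

theorem norm_toOp_inv_smul_sub_one_lt_iff {A : Matrix (Fin n) (Fin n) ℝ} (hA : A.IsHermitian)
    (c : ℝ) : ‖toOp (c⁻¹ • A - 1)‖ < 1 ↔ ∀ i, |c⁻¹ * hA.eigenvalues i - 1| < 1 := by
  rw [inv_smul_sub_one_eq_conjDiagonal hA, norm_toOp_conjDiagonal, pi_norm_lt_iff one_pos]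
  rfl

/-- Together with `exists_norm_toOp_lt`, this describes the positive definite matrices by an open
condition. -/
theorem posDef_of_norm_toOp_lt {A : Matrix (Fin n) (Fin n) ℝ} (hA : A.IsHermitian) {c : ℝ}
    (hc : 0 < c) (h : ‖toOp (c⁻¹ • A - 1)‖ < 1) : A.PosDef := by
  rw [hA.posDef_iff_eigenvalues_pos]
  intro i
  have := (abs_lt.mp ((norm_toOp_inv_smul_sub_one_lt_iff hA c).mp h i)).1
  have h2 : 0 < c⁻¹ * hA.eigenvalues i := by linarith
  exact (mul_pos_iff_of_pos_left (inv_pos.mpr hc)).mp h2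

theorem exists_norm_toOp_lt {A : Matrix (Fin n) (Fin n) ℝ} (hA : A.PosDef) :
    ∃ c : ℝ, 0 < c ∧ ‖toOp (c⁻¹ • A - 1)‖ < 1 := by
  have hpos := hA.eigenvalues_pos
  have hsum : 0 ≤ ∑ i, hA.isHermitian.eigenvalues i := Finset.sum_nonneg fun i _ => (hpos i).le
  -- This constant exceeds every eigenvalue, so the rescaled eigenvalues lie in `(0, 1)`.
  refine ⟨∑ i, hA.isHermitian.eigenvalues i + 1, by linarith, ?_⟩
  rw [norm_toOp_inv_smul_sub_one_lt_iff hA.isHermitian]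
  intro i
  have hle : hA.isHermitian.eigenvalues i ≤ ∑ i, hA.isHermitian.eigenvalues i :=
    Finset.single_le_sum (fun i _ => (hpos i).le) (Finset.mem_univ i)
  rw [inv_mul_eq_div, abs_lt]
  have h1 := div_pos (hpos i) (show 0 < ∑ i, hA.isHermitian.eigenvalues i + 1 by linarith)
  have h2 : hA.isHermitian.eigenvalues i / (∑ i, hA.isHermitian.eigenvalues i + 1) < 1 := by
    rw [div_lt_one (by linarith)]
    linarith
  constructor <;> linarith

/-- Near a positive definite matrix, the matrix logarithm is given by the logarithm series. -/
theorem toOp_matLog {A : Matrix (Fin n) (Fin n) ℝ} (hA : A.IsHermitian) {c : ℝ}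
    (hc : 0 < c) (h : ‖toOp (c⁻¹ • A - 1)‖ < 1) :
    toOp (matLog A) = Real.log c • 1 + logOneAdd (toOp (c⁻¹ • A - 1)) := by
  have hpos := (posDef_of_norm_toOp_lt hA hc h).eigenvalues_pos
  have hlt := (norm_toOp_inv_smul_sub_one_lt_iff hA c).mp h
  set U := hA.eigenvectorUnitary
  set d : Fin n → ℝ := fun i => c⁻¹ * hA.eigenvalues i - 1 with hd
  let Ψ : (Fin n → ℝ) →L[ℝ] EuclOp n :=
    LinearMap.toContinuousLinearMap (toOp.toAlgEquiv.toLinearMap ∘ₗ conjDiagonal U)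
  have hs : HasSum (fun k => logCoeff k • d ^ k) (fun i => Real.log (1 + d i)) :=
    Pi.hasSum.mpr fun i => hasSum_logCoeff (hlt i)
  have hseries : logOneAdd (toOp (c⁻¹ • A - 1)) = Ψ fun i => Real.log (1 + d i) := by
    refine ((hs.mapL Ψ).congr_fun fun k => ?_).tsum_eq
    rw [inv_smul_sub_one_eq_conjDiagonal hA, ← map_pow, conjDiagonal_pow, map_smul]
    rfl
  have hlog : Real.log ∘ hA.eigenvalues = (fun _ => Real.log c) + fun i => Real.log (1 + d i) := by
    ext i
    have : 1 + d i = c⁻¹ * hA.eigenvalues i := by simp [hd]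
    simp only [Function.comp_apply, Pi.add_apply, this]
    rw [Real.log_mul (inv_pos.mpr hc).ne' (hpos i).ne', Real.log_inv]
    ring
  rw [matLog, cfc_eq_conjDiagonal hA, hlog, map_add, conjDiagonal_const, map_add, map_smul, map_one,
    hseries]
  rfl

theorem exists_diagonalization {A : Matrix (Fin n) (Fin n) ℝ} (hA : A.IsHermitian) :
    ∃ (U : Matrix (Fin n) (Fin n) ℝ) (d : Fin n → ℝ), star U * U = 1 ∧ U * star U = 1 ∧
      A = U * diagonal d * star U ∧ ∀ f : ℝ → ℝ, cfc f A = U * diagonal (f ∘ d) * star U :=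
  ⟨hA.eigenvectorUnitary, hA.eigenvalues, Unitary.coe_star_mul_self _, Unitary.coe_mul_star_self _,
    hA.spectral_theorem.trans (conjStarAlgAut_apply _ _),
    fun f => (hA.cfc_eq f).trans (conjStarAlgAut_apply _ _)⟩

/-- If `B` is conjugate to `A⁻¹` through `T`, then `log A` and `-log B` are conjugate through `T`:
in eigenbases of `A` and `B`, the operator `T` only connects eigenvalues that are inverse to each
other. -/
theorem matLog_mul_eq_neg_mul_matLog {A B T : Matrix (Fin n) (Fin n) ℝ} (hA : A.IsHermitian)
    (hB : B.IsHermitian) (h : A * T * B = T) : matLog A * T = -(T * matLog B) := by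
  obtain ⟨U, a, hU, hU', hAU, hAf⟩ := exists_diagonalization hA
  obtain ⟨V, b, hV, hV', hBV, hBf⟩ := exists_diagonalization hB
  set K := star U * T * V with hK
  have hT : T = U * K * star V := by
    simp only [hK, ← mul_assoc, hU', one_mul]
    rw [mul_assoc, hV', mul_one]
  have hdiag : diagonal a * K * diagonal b = K := by
    calc diagonal a * K * diagonal b
        = star U * (U * diagonal a * star U * T * (V * diagonal b * star V)) * V := by
          simp only [hK, mul_assoc, hV, mul_one]
          simp only [← mul_assoc, hU, one_mul]
      _ = K := by rw [← hAU, ← hBV, h]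
  have hlog : diagonal (Real.log ∘ a) * K = -(K * diagonal (Real.log ∘ b)) := by
    ext i j
    rw [neg_apply, diagonal_mul, mul_diagonal]
    by_cases h0 : K i j = 0
    · simp [h0]
    · have hij := congrFun (congrFun hdiag i) j
      rw [mul_diagonal, diagonal_mul] at hij
      have hab : a i * b j = 1 := mul_left_cancel₀ h0 (by linarith)
      rw [Function.comp_apply, Function.comp_apply, eq_inv_of_mul_eq_one_left hab, Real.log_inv]
      ring
  calc matLog A * T = U * (diagonal (Real.log ∘ a) * K) * star V := by
        rw [matLog, hAf, hT]
        simp only [mul_assoc]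
        rw [← mul_assoc (star U) U, hU, one_mul]
    _ = -(T * matLog B) := by
        rw [hlog, matLog, hBf, hT]
        simp only [mul_assoc, mul_neg, neg_mul]
        rw [← mul_assoc (star V) V, hV, one_mul]

theorem isHermitian_coe (P : SymMat n) : (P : Matrix (Fin n) (Fin n) ℝ).IsHermitian := by
  rw [Matrix.IsHermitian, conjTranspose_eq_transpose_of_trivial]
  exact P.2

/-- The linear map `P ↦ S P S`, with values in the operators on Euclidean space. -/
noncomputable def congrOp (S : Matrix (Fin n) (Fin n) ℝ) : SymMat n →L[ℝ] EuclOp n :=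
  LinearMap.toContinuousLinearMap (toOp.toAlgEquiv.toLinearMap ∘ₗ
    LinearMap.mulRight ℝ S ∘ₗ LinearMap.mulLeft ℝ (A := Matrix (Fin n) (Fin n) ℝ) S ∘ₗ
      (SymMat n).subtype)

theorem congrOp_apply (S : Matrix (Fin n) (Fin n) ℝ) (P : SymMat n) :
    congrOp S P = toOp (S * (P : Matrix (Fin n) (Fin n) ℝ) * S) := rfl

theorem isOpen_SPD : IsOpen (SPD n) := by
  rw [isOpen_iff_mem_nhds]
  intro P hP
  obtain ⟨c, hc, hlt⟩ := exists_norm_toOp_lt hP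
  have hcont : Continuous fun X : SymMat n => ‖c⁻¹ • congrOp 1 X - 1‖ := by fun_prop
  have heq : ∀ X : SymMat n, c⁻¹ • congrOp 1 X - 1 = toOp (c⁻¹ • (X : Matrix _ _ ℝ) - 1) :=
    fun X => by rw [congrOp_apply, one_mul, mul_one, map_sub, map_smul, map_one]
  have : ∀ᶠ X in 𝓝 P, ‖c⁻¹ • congrOp 1 X - 1‖ < 1 :=
    hcont.continuousAt.eventually_lt continuousAt_const (by rwa [heq])
  filter_upwards [this] with X hX
  exact posDef_of_norm_toOp_lt (isHermitian_coe X) hc (by rwa [← heq])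

theorem convex_SPD : Convex ℝ (SPD n) := by
  rw [convex_iff_forall_pos]
  intro P hP Q hQ a b ha hb _
  exact (Matrix.PosDef.smul hP ha).add (Matrix.PosDef.smul hQ hb)

end SpectralCalculus

/-! ### The squared distance and its gradient -/

section SquaredDistance

open Matrix Filter Topology

variable {n : ℕ}

theorem matSqrt_mul_self {P : Matrix (Fin n) (Fin n) ℝ} (hP : P.PosDef) :
    matSqrt P * matSqrt P = P := by
  have hsa : IsSelfAdjoint P := hP.isHermitian
  have hfin : (spectrum ℝ P).Finite := by
    rw [hP.isHermitian.spectrum_real_eq_range_eigenvalues]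
    exact finite_range _
  have hc : ContinuousOn Real.sqrt (spectrum ℝ P) := hfin.continuousOn _
  rw [matSqrt, ← cfc_mul Real.sqrt Real.sqrt P]
  conv_rhs => rw [← cfc_id' ℝ P]
  refine cfc_congr fun x hx => Real.mul_self_sqrt ?_
  rw [hP.isHermitian.spectrum_real_eq_range_eigenvalues] at hx
  obtain ⟨i, rfl⟩ := hx
  exact (hP.eigenvalues_pos i).le

theorem isUnit_det_matSqrt {P : Matrix (Fin n) (Fin n) ℝ} (hP : P.PosDef) :
    IsUnit (matSqrt P).det := by
  have h := hP.det_pos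
  rw [← matSqrt_mul_self hP, det_mul] at h
  exact isUnit_iff_ne_zero.mpr fun h0 => by simp [h0] at h

theorem isHermitian_cfc (f : ℝ → ℝ) (A : Matrix (Fin n) (Fin n) ℝ) : (cfc f A).IsHermitian :=
  cfc_predicate f A

theorem commute_matLog (A : Matrix (Fin n) (Fin n) ℝ) (hA : A.IsHermitian) :
    Commute (matLog A) A := by
  have hsa : IsSelfAdjoint A := hA
  have h := cfc_commute_cfc (R := ℝ) Real.log id A
  rwa [cfc_id ℝ A] at h

theorem isHermitian_inv_matSqrt (P : Matrix (Fin n) (Fin n) ℝ) : (matSqrt P)⁻¹.IsHermitian :=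
  (isHermitian_cfc _ _).inv

theorem isHermitian_congr {S A : Matrix (Fin n) (Fin n) ℝ} (hS : S.IsHermitian)
    (hA : A.IsHermitian) : (S * A * S).IsHermitian := by
  have := isHermitian_mul_mul_conjTranspose S hA
  rwa [hS.eq] at this

theorem posDef_congr {S A : Matrix (Fin n) (Fin n) ℝ} (hS : S.IsHermitian) (hdet : IsUnit S.det)
    (hA : A.PosDef) : (S * A * S).PosDef := by
  have h := ((isUnit_iff_isUnit_det S).mpr hdet).posDef_star_right_conjugate_iff (x := A)
  rw [star_eq_conjTranspose, hS.eq] at h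
  exact h.mpr hA

theorem posDef_inv_matSqrt_congr {P A : Matrix (Fin n) (Fin n) ℝ} (hP : P.PosDef)
    (hA : A.PosDef) : ((matSqrt P)⁻¹ * A * (matSqrt P)⁻¹).PosDef :=
  posDef_congr (isHermitian_inv_matSqrt P) (isUnit_nonsing_inv_det _ (isUnit_det_matSqrt hP)) hA

theorem spdDist_sq (P Q : SymMat n) :
    spdDist P Q ^ 2 = (relLog (P : Matrix (Fin n) (Fin n) ℝ) Q ^ 2).trace := by
  have hL : (relLog (P : Matrix (Fin n) (Fin n) ℝ) Q).IsHermitian := isHermitian_cfc _ _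
  rw [spdDist, Real.sq_sqrt]
  have h :=
    (posSemidef_conjTranspose_mul_self (relLog (P : Matrix (Fin n) (Fin n) ℝ) Q)).trace_nonneg
  rwa [hL.eq, ← sq] at h

/-- The trace, as a functional on operators of Euclidean space. -/
noncomputable def opTrace (n : ℕ) : EuclOp n →L[ℝ] ℝ :=
  LinearMap.toContinuousLinearMap
    (Matrix.traceLinearMap (Fin n) ℝ ℝ ∘ₗ (toOp (n := n)).symm.toAlgEquiv.toLinearMap)

theorem opTrace_toOp (A : Matrix (Fin n) (Fin n) ℝ) : opTrace n (toOp A) = A.trace :=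
  congrArg Matrix.trace (toOp.symm_apply_apply A)

theorem opTrace_mul_comm (a b : EuclOp n) : opTrace n (a * b) = opTrace n (b * a) := by
  obtain ⟨A, rfl⟩ := toOp.surjective a
  obtain ⟨B, rfl⟩ := toOp.surjective b
  change opTrace n (toOp A * toOp B) = opTrace n (toOp B * toOp A)
  rw [← map_mul, ← map_mul, opTrace_toOp, opTrace_toOp, trace_mul_comm]

/-- `log c` plus the logarithm series at `c⁻¹ • S P S - 1`, which represents `log (S P S)`. -/
noncomputable def congrLog (S : Matrix (Fin n) (Fin n) ℝ) (c : ℝ) (P : SymMat n) : EuclOp n :=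
  Real.log c • 1 + logOneAdd (c⁻¹ • congrOp S P - 1)

theorem inv_smul_congrOp_sub_one (S : Matrix (Fin n) (Fin n) ℝ) (c : ℝ) (P : SymMat n) :
    c⁻¹ • congrOp S P - 1 = toOp (c⁻¹ • (S * (P : Matrix (Fin n) (Fin n) ℝ) * S) - 1) := by
  rw [congrOp_apply, map_sub, map_smul, map_one]

theorem eventually_spdDist_sq_eq {R P : SymMat n} {c : ℝ} (hc : 0 < c)
    (hlt : ‖c⁻¹ • congrOp (matSqrt (R : Matrix (Fin n) (Fin n) ℝ))⁻¹ P - 1‖ < 1) :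
    (fun X => spdDist R X ^ 2) =ᶠ[𝓝 P] fun X =>
      opTrace n (congrLog (matSqrt (R : Matrix (Fin n) (Fin n) ℝ))⁻¹ c X *
        congrLog (matSqrt (R : Matrix (Fin n) (Fin n) ℝ))⁻¹ c X) := by
  set S := (matSqrt (R : Matrix (Fin n) (Fin n) ℝ))⁻¹ with hS
  have hcont : Continuous fun X : SymMat n => ‖c⁻¹ • congrOp S X - 1‖ := by fun_prop
  filter_upwards [hcont.continuousAt.eventually_lt continuousAt_const hlt] with X hX
  rw [inv_smul_congrOp_sub_one] at hX
  rw [spdDist_sq, congrLog, inv_smul_congrOp_sub_one, ← toOp_matLog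
    (isHermitian_congr (isHermitian_inv_matSqrt _) (isHermitian_coe X)) hc hX, ← map_mul,
    opTrace_toOp, ← sq]
  rfl

theorem exists_norm_congrOp_lt {R P : SymMat n} (hR : R ∈ SPD n) (hP : P ∈ SPD n) :
    ∃ c : ℝ, 0 < c ∧ ‖c⁻¹ • congrOp (matSqrt (R : Matrix (Fin n) (Fin n) ℝ))⁻¹ P - 1‖ < 1 := by
  obtain ⟨c, hc, hlt⟩ := exists_norm_toOp_lt (posDef_inv_matSqrt_congr hR hP)
  exact ⟨c, hc, by rwa [inv_smul_congrOp_sub_one]⟩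

theorem analyticAt_congrLog {S : Matrix (Fin n) (Fin n) ℝ} {c : ℝ} {P : SymMat n}
    (hlt : ‖c⁻¹ • congrOp S P - 1‖ < 1) : AnalyticAt ℝ (congrLog S c) P := by
  have h1 : AnalyticAt ℝ (fun X => (c⁻¹ • congrOp S) X - 1) P :=
    (((c⁻¹ • congrOp S).analyticAt P).sub analyticAt_const)
  have h2 := analyticOnNhd_logOneAdd (c⁻¹ • congrOp S P - 1) (mem_ball_zero_iff.mpr hlt)
  exact analyticAt_const.add (AnalyticAt.fun_comp (f := fun X => (c⁻¹ • congrOp S) X - 1) h2 h1)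

theorem analyticAt_spdDist_sq {R P : SymMat n} (hR : R ∈ SPD n) (hP : P ∈ SPD n) :
    AnalyticAt ℝ (fun X => spdDist R X ^ 2) P := by
  obtain ⟨c, hc, hlt⟩ := exists_norm_congrOp_lt hR hP
  have h := analyticAt_congrLog hlt
  exact (((opTrace n).analyticAt _).fun_comp (h.mul h)).congr (eventually_spdDist_sq_eq hc hlt).symm

/-- The derivative of `P ↦ Tr (log (S P S)²)`, for `S = R^{-1/2}`: the scalar rule
`(log²)' x = 2 log x / x` holds under the trace. -/
theorem fderiv_spdDist_sq_apply {R P : SymMat n} (hR : R ∈ SPD n) (hP : P ∈ SPD n) (V : SymMat n) :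
    fderiv ℝ (fun X => spdDist R X ^ 2) P V =
      2 * (relLog (R : Matrix (Fin n) (Fin n) ℝ) P *
        ((matSqrt (R : Matrix (Fin n) (Fin n) ℝ))⁻¹ * P *
          (matSqrt (R : Matrix (Fin n) (Fin n) ℝ))⁻¹)⁻¹ *
        ((matSqrt (R : Matrix (Fin n) (Fin n) ℝ))⁻¹ * V *
          (matSqrt (R : Matrix (Fin n) (Fin n) ℝ))⁻¹)).trace := by
  obtain ⟨c, hc, hlt⟩ := exists_norm_congrOp_lt hR hP
  have hM := posDef_inv_matSqrt_congr hR hP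
  rw [(eventually_spdDist_sq_eq hc hlt).fderiv_eq, relLog]
  set S := (matSqrt (R : Matrix (Fin n) (Fin n) ℝ))⁻¹ with hS
  set M := S * (P : Matrix (Fin n) (Fin n) ℝ) * S with hMdef
  set y := c⁻¹ • congrOp S P - 1 with hy
  have hy' : y = toOp (c⁻¹ • M - 1) := inv_smul_congrOp_sub_one S c P
  have hL : congrLog S c P = toOp (matLog M) := by
    rw [congrLog, toOp_matLog hM.isHermitian hc (by rwa [← hy']), ← hy, hy']
  have hlog : HasFDerivAt logOneAdd (fderiv ℝ logOneAdd y) y :=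
    (analyticOnNhd_logOneAdd y (mem_ball_zero_iff.mpr hlt)).differentiableAt.hasFDerivAt
  have hinner : HasFDerivAt (fun X => c⁻¹ • congrOp S X - 1) (c⁻¹ • congrOp S) P :=
    (c⁻¹ • congrOp S).hasFDerivAt.sub_const _
  have hcL : HasFDerivAt (congrLog S c) (fderiv ℝ logOneAdd y ∘L (c⁻¹ • congrOp S)) P :=
    (hlog.comp P hinner).const_add _
  have hF := (opTrace n).hasFDerivAt.comp P (hcL.mul' hcL)
  have hcomm : Commute (toOp (matLog M)) y := by
    rw [hy']
    refine Commute.map ?_ toOp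
    exact ((commute_matLog M hM.isHermitian).smul_right _).sub_right (Commute.one_right _)
  have hunit : IsUnit M.det := hM.det_pos.ne'.isUnit
  have hB : toOp (c • M⁻¹) * (1 + y) = 1 := by
    rw [hy', ← map_one toOp, ← map_add, ← map_mul, add_sub_cancel, smul_mul_smul_comm,
      mul_inv_cancel₀ hc.ne', nonsing_inv_mul _ hunit, one_smul]
  have key := apply_mul_fderiv_logOneAdd (opTrace n) opTrace_mul_comm hlt hcomm hB
    (c⁻¹ • congrOp S V)
  have h2 : opTrace n (toOp (matLog M) * toOp (c • M⁻¹) * (c⁻¹ • congrOp S V)) =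
      (matLog M * M⁻¹ * (S * (V : Matrix (Fin n) (Fin n) ℝ) * S)).trace := by
    rw [congrOp_apply, ← map_smul, ← map_mul, ← map_mul, opTrace_toOp, mul_smul_comm, mul_smul_comm,
      smul_mul_assoc, smul_smul, inv_mul_cancel₀ hc.ne', one_smul]
  rw [← h2, ← key]
  refine (congrArg (fun D => D V) hF.fderiv).trans ?_
  change opTrace n (congrLog S c P * fderiv ℝ logOneAdd y (c⁻¹ • congrOp S V) +
    fderiv ℝ logOneAdd y (c⁻¹ • congrOp S V) * congrLog S c P) = _
  rw [map_add, opTrace_mul_comm (fderiv ℝ logOneAdd y _), hL, two_mul]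

/-- The gradient of the squared distance: `D_P d(R, P)² [V] = -2 ⟨log_P R, V⟩_P`. -/
theorem fderiv_spdDist_sq_eq_inner {R P : SymMat n} (hR : R ∈ SPD n) (hP : P ∈ SPD n)
    (V : SymMat n) :
    fderiv ℝ (fun X => spdDist R X ^ 2) P V =
      -2 * ((P : Matrix (Fin n) (Fin n) ℝ)⁻¹ * spdLog P R * (P : Matrix (Fin n) (Fin n) ℝ)⁻¹ *
        V).trace := by
  rw [fderiv_spdDist_sq_apply hR hP]
  have hRR := matSqrt_mul_self hR
  have hPP := matSqrt_mul_self hP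
  have hRd := isUnit_det_matSqrt hR
  have hPd := isUnit_det_matSqrt hP
  have hRh := posDef_inv_matSqrt_congr hR hP
  have hPh := posDef_inv_matSqrt_congr hP hR
  change _ = -2 * ((P : Matrix (Fin n) (Fin n) ℝ)⁻¹ * (matSqrt (P : Matrix (Fin n) (Fin n) ℝ) *
    relLog (P : Matrix (Fin n) (Fin n) ℝ) R * matSqrt (P : Matrix (Fin n) (Fin n) ℝ)) *
    (P : Matrix (Fin n) (Fin n) ℝ)⁻¹ * V).trace
  rw [relLog, relLog]
  generalize (R : Matrix (Fin n) (Fin n) ℝ) = R at *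
  generalize (P : Matrix (Fin n) (Fin n) ℝ) = P at *
  generalize (V : Matrix (Fin n) (Fin n) ℝ) = V at *
  generalize matSqrt R = r at *
  generalize matSqrt P = p at *
  have hr1 : ∀ X, r * (r⁻¹ * X) = X := fun X => mul_nonsing_inv_cancel_left _ X hRd
  have hr2 : ∀ X, r⁻¹ * (r * X) = X := fun X => nonsing_inv_mul_cancel_left _ X hRd
  have hp1 : ∀ X, p * (p⁻¹ * X) = X := fun X => mul_nonsing_inv_cancel_left _ X hPd
  have hp2 : ∀ X, p⁻¹ * (p * X) = X := fun X => nonsing_inv_mul_cancel_left _ X hPd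
  have hconj : matLog (p⁻¹ * R * p⁻¹) * (p * r⁻¹) = -(p * r⁻¹ * matLog (r⁻¹ * P * r⁻¹)) := by
    refine matLog_mul_eq_neg_mul_matLog hPh.isHermitian hRh.isHermitian ?_
    simp only [← hRR, ← hPP, mul_assoc, hr1, hp2]
  have hPinv : P⁻¹ = p⁻¹ * p⁻¹ := by rw [← hPP, Matrix.mul_inv_rev]
  have hMinv : (r⁻¹ * P * r⁻¹)⁻¹ = r * (p⁻¹ * (p⁻¹ * r)) := by
    rw [Matrix.mul_inv_rev, Matrix.mul_inv_rev, nonsing_inv_nonsing_inv _ hRd, hPinv, mul_assoc]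
  generalize matLog (p⁻¹ * R * p⁻¹) = Λ at *
  generalize matLog (r⁻¹ * P * r⁻¹) = L at *
  have hΛ : Λ = -(p * (r⁻¹ * (L * (r * p⁻¹)))) := by
    have h := congrArg (fun X => X * (r * p⁻¹)) hconj
    simp only [mul_assoc, neg_mul, hr2, mul_nonsing_inv _ hPd, mul_one] at h
    exact h
  have htr : (L * (r⁻¹ * P * r⁻¹)⁻¹ * (r⁻¹ * V * r⁻¹)).trace =
      (r⁻¹ * (L * (r * (p⁻¹ * (p⁻¹ * V))))).trace := by
    rw [trace_mul_comm r⁻¹, hMinv]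
    simp only [mul_assoc, hr1]
  rw [htr, hPinv, hΛ]
  simp only [mul_assoc, neg_mul, mul_neg, hp1, hp2, trace_neg, neg_neg]

end SquaredDistance

/-! ### The rank of the differential of the squared Fréchet map -/

section Rank

open Matrix

variable {n ℓ : ℕ}

theorem finrank_symMat (n : ℕ) : Module.finrank ℝ (SymMat n) = symDim n := by
  rw [(symCoords n).finrank_eq, Module.finrank_fintype_fun_eq_card, symDim]
  let e : {p : Fin n × Fin n // p.1 ≤ p.2} ≃ Sym2 (Fin n) := Sym2.sortEquiv.symm
  rw [Fintype.card_congr e, Sym2.card, Fintype.card_fin, Nat.choose_two_right, Nat.add_sub_cancel,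
    mul_comm]

/-- The affine-invariant metric `⟨W, V⟩_P = Tr (P⁻¹ W P⁻¹ V)` on `Sym(n)`. -/
noncomputable def affineForm (P : SymMat n) : LinearMap.BilinForm ℝ (SymMat n) :=
  LinearMap.mk₂ ℝ (fun W V => ((P : Matrix (Fin n) (Fin n) ℝ)⁻¹ * (W : Matrix (Fin n) (Fin n) ℝ) *
    (P : Matrix (Fin n) (Fin n) ℝ)⁻¹ * (V : Matrix (Fin n) (Fin n) ℝ)).trace)
    (fun W W' V => by simp [mul_add, add_mul]) (fun c W V => by simp)
    (fun W V V' => by simp [mul_add]) (fun c W V => by simp)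

theorem affineForm_apply (P W V : SymMat n) :
    affineForm P W V = ((P : Matrix (Fin n) (Fin n) ℝ)⁻¹ * W *
      (P : Matrix (Fin n) (Fin n) ℝ)⁻¹ * V).trace := rfl

theorem eq_zero_of_affineForm_self {P W : SymMat n} (hP : P ∈ SPD n) (h : affineForm P W W = 0) :
    W = 0 := by
  have hp := isUnit_det_matSqrt hP
  have hPP := matSqrt_mul_self hP
  have hWs := isHermitian_congr (isHermitian_inv_matSqrt (P : Matrix (Fin n) (Fin n) ℝ))
    (isHermitian_coe W)
  rw [affineForm_apply] at h
  have hPinv : (P : Matrix (Fin n) (Fin n) ℝ)⁻¹ = (matSqrt (P : Matrix (Fin n) (Fin n) ℝ))⁻¹ *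
      (matSqrt (P : Matrix (Fin n) (Fin n) ℝ))⁻¹ := by
    rw [← Matrix.mul_inv_rev, hPP]
  rw [hPinv] at h
  set p := matSqrt (P : Matrix (Fin n) (Fin n) ℝ)
  -- The form is the Frobenius square of the symmetric matrix `P^{-1/2} W P^{-1/2}`.
  have h0 : p⁻¹ * (W : Matrix (Fin n) (Fin n) ℝ) * p⁻¹ = 0 := by
    rw [← trace_conjTranspose_mul_self_eq_zero_iff, hWs.eq, ← h, mul_assoc p⁻¹ p⁻¹,
      mul_assoc p⁻¹ (p⁻¹ * _), mul_assoc p⁻¹ _ (W : Matrix (Fin n) (Fin n) ℝ), trace_mul_comm p⁻¹]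
    simp only [mul_assoc]
  have h1 := congrArg (fun X => p * X * p) h0
  simp only [mul_assoc, mul_zero, zero_mul, nonsing_inv_mul _ hp, mul_one] at h1
  rw [mul_nonsing_inv_cancel_left _ _ hp] at h1
  exact Subtype.ext h1

theorem affineForm_nondegenerate {P : SymMat n} (hP : P ∈ SPD n) : (affineForm P).Nondegenerate :=
  ⟨fun W h => eq_zero_of_affineForm_self hP (h W), fun W h => eq_zero_of_affineForm_self hP (h W)⟩

theorem analyticAt_frechetMap {R : Fin ℓ → SymMat n} (hR : ∀ i, R i ∈ SPD n) {P : SymMat n}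
    (hP : P ∈ SPD n) : AnalyticAt ℝ (frechetMap R) P :=
  AnalyticAt.pi fun i => analyticAt_spdDist_sq (hR i) hP

theorem fderiv_frechetMap_apply {R : Fin ℓ → SymMat n} (hR : ∀ i, R i ∈ SPD n) {P : SymMat n}
    (hP : P ∈ SPD n) (V : SymMat n) (i : Fin ℓ) :
    fderiv ℝ (frechetMap R) P V i = -2 * affineForm P (spdLog P (R i)) V := by
  have h : HasFDerivAt (frechetMap R) _ P :=
    hasFDerivAt_pi.mpr fun i => (analyticAt_spdDist_sq (hR i) hP).differentiableAt.hasFDerivAt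
  rw [h.fderiv]
  exact fderiv_spdDist_sq_eq_inner (hR i) hP V

/-- The kernel of the differential is the orthogonal complement of the logarithms. -/
theorem ker_fderiv_frechetMap {R : Fin ℓ → SymMat n} (hR : ∀ i, R i ∈ SPD n) {P : SymMat n}
    (hP : P ∈ SPD n) :
    LinearMap.ker (fderiv ℝ (frechetMap R) P).toLinearMap =
      (affineForm P).orthogonal (Submodule.span ℝ (range fun i => spdLog P (R i))) := by
  ext V
  have h1 : V ∈ LinearMap.ker (fderiv ℝ (frechetMap R) P).toLinearMap ↔
      ∀ i, affineForm P (spdLog P (R i)) V = 0 := by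
    rw [LinearMap.mem_ker, funext_iff]
    refine forall_congr' fun i => ?_
    change fderiv ℝ (frechetMap R) P V i = 0 ↔ _
    rw [fderiv_frechetMap_apply hR hP]
    simp
  rw [h1, LinearMap.BilinForm.mem_orthogonal_iff]
  refine ⟨fun h W hW => ?_, fun h i => h _ (Submodule.subset_span (mem_range_self i))⟩
  change affineForm P W V = 0
  induction hW using Submodule.span_induction with
  | mem W hW => obtain ⟨i, rfl⟩ := hW; exact h i
  | zero => simp
  | add W W' _ _ h1 h2 => rw [map_add, LinearMap.add_apply, h1, h2, add_zero]
  | smul c W _ h1 => rw [map_smul, LinearMap.smul_apply, h1, smul_zero]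

theorem diffRank_eq_logRank {R : Fin ℓ → SymMat n} (hR : ∀ i, R i ∈ SPD n) {P : SymMat n}
    (hP : P ∈ SPD n) : diffRank R P = logRank R P := by
  have h1 := LinearMap.finrank_range_add_finrank_ker (fderiv ℝ (frechetMap R) P).toLinearMap
  rw [ker_fderiv_frechetMap hR hP,
    LinearMap.BilinForm.finrank_orthogonal (affineForm_nondegenerate hP)] at h1
  have h2 := (Submodule.span ℝ (range fun i => spdLog P (R i))).finrank_le
  rw [diffRank, logRank]
  omega

theorem diffRank_le (R : Fin ℓ → SymMat n) (P : SymMat n) : diffRank R P ≤ symDim n :=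
  (LinearMap.finrank_range_le _).trans_eq (finrank_symMat n)

theorem diffRank_eq_symDim_iff (R : Fin ℓ → SymMat n) (P : SymMat n) :
    diffRank R P = symDim n ↔ LinearMap.ker (fderiv ℝ (frechetMap R) P).toLinearMap = ⊥ := by
  have h1 := LinearMap.finrank_range_add_finrank_ker (fderiv ℝ (frechetMap R) P).toLinearMap
  rw [← Submodule.finrank_eq_zero, diffRank, ← finrank_symMat]
  omega

end Rank

/-! ### Zero sets of analytic functions -/

section AnalyticZeros

open Filter Topology

/-- The zero set of an analytic function on a convex open set is a null set, unless the function
vanishes identically. Every line through a point `a` with `f a ≠ 0` meets the zero set in a null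
set; hence so does the union of the dilates of the zero set about `a`, by Fubini's theorem almost
every dilate is a null set, and dilations preserve null sets. -/
theorem addHaar_analyticZeros_eq_zero {E : Type*} [NormedAddCommGroup E] [NormedSpace ℝ E]
    [FiniteDimensional ℝ E] [MeasurableSpace E] [BorelSpace E] (μ : Measure E)
    [μ.IsAddHaarMeasure] {U : Set E} (hU : IsOpen U) (hUc : Convex ℝ U) {f : E → ℝ}
    (hf : AnalyticOnNhd ℝ f U) {a : E} (ha : a ∈ U) (hfa : f a ≠ 0) :
    μ {x ∈ U | f x = 0} = 0 := by
  set Z : Set E := {x ∈ U | f x = 0} with hZ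
  have hZm : MeasurableSet Z := by
    have : Z = U \ (U ∩ f ⁻¹' {0}ᶜ) := by
      ext x
      simp [hZ]
    rw [this]
    exact hU.measurableSet.diff
      (hf.continuousOn.isOpen_inter_preimage hU isOpen_compl_singleton).measurableSet
  set Z' : Set E := (a + ·) ⁻¹' Z with hZ'
  have hZ'm : MeasurableSet Z' := measurable_const_add a hZm
  have hZ'0 : μ Z' = μ Z := measure_preimage_add μ a Z
  rw [← hZ'0]
  -- Each line through `a` meets the zero set in a null set.
  have hline : ∀ v : E, (volume : Measure ℝ) {t | t • v ∈ Z'} = 0 := by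
    intro v
    set J : Set ℝ := (fun t : ℝ => a + t • v) ⁻¹' U with hJ
    have hJo : IsOpen J := hU.preimage (by fun_prop)
    have hJc : Convex ℝ J := by
      intro s hs t ht p q hp hq hpq
      have h := hUc hs ht hp hq hpq
      have he : p • (a + s • v) + q • (a + t • v) = a + (p • s + q • t) • v := by
        calc _ = (p + q) • a + (p • s + q • t) • v := by
              simp only [smul_eq_mul]; module
          _ = _ := by rw [hpq, one_smul]
      rw [hJ, mem_preimage, ← he]
      exact h
    have h0 : (0 : ℝ) ∈ J := by simpa [hJ] using ha
    have hg : AnalyticOnNhd ℝ (fun t : ℝ => f (a + t • v)) J := fun t ht =>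
      (hf _ ht).fun_comp (f := fun t : ℝ => a + t • v) (by fun_prop)
    have hcod := hg.preimage_zero_mem_codiscreteWithin (x := 0) (by simpa using hfa) h0
      ⟨⟨0, h0⟩, hJc.isPreconnected⟩
    have hae := ae_restrict_le_codiscreteWithin (μ := volume) hJo.measurableSet hcod
    have hnull := mem_ae_iff.mp hae
    rw [Measure.restrict_apply' hJo.measurableSet] at hnull
    refine measure_mono_null (fun t ht => ?_) hnull
    have ht' : a + t • v ∈ U ∧ f (a + t • v) = 0 := ht
    exact ⟨by simpa using ht'.2, ht'.1⟩
  have hS : MeasurableSet {p : E × ℝ | p.2 • p.1 ∈ Z'} :=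
    (measurable_snd.smul measurable_fst) hZ'm
  have hprod : (volume : Measure ℝ).prod μ (Prod.swap ⁻¹' {p : E × ℝ | p.2 • p.1 ∈ Z'}) = 0 := by
    have h1 : μ.prod (volume : Measure ℝ) {p : E × ℝ | p.2 • p.1 ∈ Z'} = 0 :=
      Measure.measure_prod_null_of_ae_null hS (Eventually.of_forall hline)
    rw [← Measure.prod_swap (μ := μ),
      Measure.map_apply measurable_swap (hS.preimage measurable_swap)]
    exact h1
  have hae := Measure.measure_ae_null_of_prod_null hprod
  have hne : ∀ᵐ t : ℝ, t ≠ 0 := by simp [ae_iff]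
  obtain ⟨t, ht, ht0⟩ := (hae.and hne).exists
  have ht' : μ ((t • ·) ⁻¹' Z') = 0 := ht
  rw [Measure.addHaar_preimage_smul μ ht0] at ht'
  refine (mul_eq_zero.mp ht').resolve_left ?_
  rw [ENNReal.ofReal_eq_zero, not_le, abs_pos]
  exact inv_ne_zero (pow_ne_zero _ ht0)

end AnalyticZeros

/-! ### Analytic maps with injective differential -/

section InjectiveDifferential

open Filter Topology

variable {E F : Type*} [NormedAddCommGroup E] [NormedSpace ℝ E] [NormedAddCommGroup F]
  [NormedSpace ℝ F]

theorem exists_continuous_leftInverse [FiniteDimensional ℝ F] {T : E →L[ℝ] F}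
    (hT : LinearMap.ker T.toLinearMap = ⊥) :
    ∃ L : F →L[ℝ] E, L ∘L T = ContinuousLinearMap.id ℝ E := by
  obtain ⟨L, hL⟩ := T.toLinearMap.exists_leftInverse_of_injective hT
  exact ⟨LinearMap.toContinuousLinearMap L,
    ContinuousLinearMap.ext fun v => LinearMap.congr_fun hL v⟩

/-- An analytic function, a determinant formed from the differential of `f`, that
certifies the injectivity of the differential: given a left inverse `L` of the differential at one
point, it is `x ↦ det (L ∘ Df(x))`. -/
theorem exists_analytic_ne_zero_imp_injective [FiniteDimensional ℝ E] [FiniteDimensional ℝ F]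
    {f : E → F} {U : Set E}
    (hf : AnalyticOnNhd ℝ f U) {a : E}
    (hinj : LinearMap.ker (fderiv ℝ f a).toLinearMap = ⊥) :
    ∃ g : E → ℝ, AnalyticOnNhd ℝ g U ∧ g a ≠ 0 ∧
      ∀ x, g x ≠ 0 → LinearMap.ker (fderiv ℝ f x).toLinearMap = ⊥ := by
  obtain ⟨L, hL⟩ := exists_continuous_leftInverse hinj
  let b := Module.finBasis ℝ E
  refine ⟨fun x => LinearMap.det (L ∘L fderiv ℝ f x).toLinearMap, fun x hx => ?_, ?_,
    fun x hx => ?_⟩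
  · have h : ∀ i j, AnalyticAt ℝ (fun y => b.repr (L (fderiv ℝ f y (b j))) i) x := fun i j => by
      let C : (E →L[ℝ] F) →L[ℝ] ℝ := LinearMap.toContinuousLinearMap (b.coord i) ∘L L ∘L
        ContinuousLinearMap.apply ℝ F (b j)
      exact (C.analyticAt _).fun_comp (hf x hx).fderiv
    simp_rw [← LinearMap.det_toMatrix b, Matrix.det_apply, LinearMap.toMatrix_apply]
    refine Finset.analyticAt_fun_sum _ fun σ _ => ?_
    simp_rw [Units.smul_def, zsmul_eq_mul]
    exact analyticAt_const.mul <| Finset.analyticAt_fun_prod _ fun i _ => h _ _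
  · simp only [hL]
    exact (LinearMap.det_id (M := E) (A := ℝ)).trans_ne one_ne_zero
  · rw [LinearMap.ker_eq_bot]
    have h : Function.Injective (L ∘L fderiv ℝ f x).toLinearMap :=
      (LinearEquiv.ofIsUnitDet (f := (L ∘L fderiv ℝ f x).toLinearMap)
        (v := b) (v' := b) (by rw [LinearMap.det_toMatrix]; exact hx.isUnit)).injective
    exact Function.Injective.of_comp (f := L) h

/-- A map with injective differential at a point at which it is analytic has an analytic local left
inverse: a linear left inverse `L` of the differential makes `L ∘ f` a local diffeomorphism. -/
theorem exists_local_leftInverse [FiniteDimensional ℝ E] [FiniteDimensional ℝ F]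
    {f : E → F} {a : E} (hf : AnalyticAt ℝ f a)
    (hinj : LinearMap.ker (fderiv ℝ f a).toLinearMap = ⊥) :
    ∃ (W : Set F) (G : F → E), IsOpen W ∧ f a ∈ W ∧ ContDiffOn ℝ ∞ G W ∧
      ∀ᶠ x in 𝓝 a, G (f x) = x := by
  have : CompleteSpace E := FiniteDimensional.complete ℝ E
  obtain ⟨L, hL⟩ := exists_continuous_leftInverse hinj
  have hg : ContDiffAt ℝ ω (fun x => L (f x)) a := ((L.analyticAt _).fun_comp hf).contDiffAt
  have hg' : HasFDerivAt (fun x => L (f x)) (ContinuousLinearEquiv.refl ℝ E : E →L[ℝ] E) a := by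
    have h := L.hasFDerivAt.comp a hf.differentiableAt.hasFDerivAt
    rw [hL] at h
    exact h
  have hω : (ω : WithTop ℕ∞) ≠ 0 := by simp
  have hinv := hg.to_localInverse hg' hω
  have hinf : (ω : WithTop ℕ∞) ≠ ∞ := by simp
  -- Being `C^∞` at a point gives no common neighbourhood for all orders; being analytic does.
  obtain ⟨O, hO, hOo, hmem⟩ := eventually_nhds_iff.mp (hinv.eventually hinf)
  refine ⟨L ⁻¹' O, hg.localInverse hg' hω ∘ L, hOo.preimage L.continuous, hmem, fun y hy => ?_, ?_⟩
  · exact (((hO (L y) hy).of_le le_top).comp y L.contDiff.contDiffAt).contDiffWithinAt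
  · exact (hg.hasStrictFDerivAt' hg' hω).eventually_left_inverse

end InjectiveDifferential

/-! ### The full rank set -/

/-- The logarithms have full rank exactly where the differential is injective; unlike the rank of
the logarithms, the latter condition involves only the analytic map `F`. -/
theorem mem_fullRankSet_iff {n ℓ : ℕ} {R : Fin ℓ → SymMat n} (hR : ∀ i, R i ∈ SPD n)
    {P : SymMat n} : P ∈ fullRankSet R ↔
      P ∈ SPD n ∧ LinearMap.ker (fderiv ℝ (frechetMap R) P).toLinearMap = ⊥ :=
  and_congr_right fun hP => by rw [← diffRank_eq_logRank hR hP, diffRank_eq_symDim_iff]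

theorem mainTheorem3 {n ℓ : ℕ} (R : Fin ℓ → SymMat n) (hR : ∀ i, R i ∈ SPD n)
    (hℓ : symDim n ≤ ℓ)
    (hQ : ∃ Q ∈ SPD n, logRank R Q = symDim n) :
    (∀ P ∈ SPD n, DifferentiableAt ℝ (frechetMap R) P) ∧
    rankDeficientSet R = SPD n \ fullRankSet R ∧
    symLebesgue n (rankDeficientSet R) = 0 ∧
    IsOpen (fullRankSet R) ∧
    symLebesgue n (SPD n \ fullRankSet R) = 0 ∧
    ∀ P ∈ fullRankSet R, LocallyInvertibleAt R P := by
  have hF : AnalyticOnNhd ℝ (frechetMap R) (SPD n) := fun P hP => analyticAt_frechetMap hR hP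
  have hS : rankDeficientSet R = SPD n \ fullRankSet R := by
    ext P
    refine and_congr_right fun hP => ?_
    rw [(diffRank_le R P).lt_iff_ne, diffRank_eq_logRank hR hP]
    exact not_congr (iff_and_self.mpr fun _ => hP)
  have hnull : symLebesgue n (SPD n \ fullRankSet R) = 0 := by
    obtain ⟨Q, hQ, hrank⟩ := hQ
    obtain ⟨g, hg, hgQ, hker⟩ := exists_analytic_ne_zero_imp_injective hF
      ((mem_fullRankSet_iff hR).mp ⟨hQ, hrank⟩).2
    have hzero : symLebesgue n {P ∈ SPD n | g P = 0} = 0 :=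
      @addHaar_analyticZeros_eq_zero (SymMat n) _ _ _ _ ⟨rfl⟩ (symLebesgue n)
        (inferInstanceAs (symLebesgue n).IsAddHaarMeasure) _ isOpen_SPD convex_SPD g hg Q hQ hgQ
    have hsub : SPD n \ fullRankSet R ⊆ {P ∈ SPD n | g P = 0} := fun P hP => by
      refine ⟨hP.1, ?_⟩
      by_contra h0
      exact hP.2 ((mem_fullRankSet_iff hR).mpr ⟨hP.1, hker P h0⟩)
    exact measure_mono_null hsub hzero
  have hopen : IsOpen (fullRankSet R) := by
    rw [isOpen_iff_mem_nhds]
    intro P hP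
    obtain ⟨hP, hinj⟩ := (mem_fullRankSet_iff hR).mp hP
    obtain ⟨g, hg, hgP, hker⟩ := exists_analytic_ne_zero_imp_injective hF hinj
    filter_upwards [isOpen_SPD.mem_nhds hP, (hg P hP).continuousAt.eventually_ne hgP] with X hX hgX
    exact (mem_fullRankSet_iff hR).mpr ⟨hX, hker X hgX⟩
  refine ⟨fun P hP => (hF P hP).differentiableAt, hS, hS ▸ hnull, hopen, hnull, fun P hP => ?_⟩
  obtain ⟨hP, hinj⟩ := (mem_fullRankSet_iff hR).mp hP
  refine ⟨(diffRank_eq_symDim_iff R P).mpr hinj, ?_⟩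
  obtain ⟨W, G, hW, hPW, hG, hleft⟩ := exists_local_leftInverse (hF P hP) hinj
  obtain ⟨U, hU, hUo, hPU⟩ := eventually_nhds_iff.mp
    ((hleft.and ((hF P hP).continuousAt.eventually (hW.mem_nhds hPW))).and
      (isOpen_SPD.mem_nhds hP))
  exact ⟨U, hUo, hPU, fun X hX => (hU X hX).2,
    fun X hX => (hF X (hU X hX).2).contDiffAt.contDiffWithinAt,
    W, G, hW, fun X hX => (hU X hX).1.2, hG, fun X hX => (hU X hX).1.1⟩
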